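/- Let $k$ be a commutative ring. Let $k\mathcal C$ be the category whose objects are the finite sets and in which the morphisms from $X$ to $Y$ form the free $k$-module $k\mathcal C(Y,X)$ on the set $\mathcal C(Y,X)$ of all correspondences $S\subseteq Y\times X$, composed $k$-bilinearly by $RS=\{(z,x)\mid \exists y,\ (z,y)\in R,\ (y,x)\in S\}$; write $\Delta_E$ for the identity relation. A correspondence functor is a $k$-linear functor $k\mathcal C\to k\text{-Mod}$; a morphism of such functors is a natural transformation, and it is surjective if all its components are. For a finite set $E$, let $\mathcal P_E$ be the quotient of the algebra $k\mathcal C(E,E)$ by the two-sided ideal generated by all relations that factor through a set of cardinality smaller than $|E|$ and by all differences $S-\overline S$, where $S$ is a reflexive relation and $\overline S$ its transitive closure. For a partial order $R$ on $E$ put $f_R=\sum_{S\supseteq R}\mu(R,S)\,S\in\mathcal P_E$, where $S$ runs over the partial orders on $E$ containing $R$ and $\mu$ is the Möbius function of the poset of partial orders on $E$ ordered by inclusion. Let $W=\mathcal P_Ef_R$ be the left ideal generated by $f_R$, viewed as a $k\mathcal C(E,E)$-module. Let $L_{E,W}=k\mathcal C(-,E)\otimes_{k\mathcal C(E,E)}W$,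 let $J_{E,W}$ be its subfunctor $$J_{E,W}(X)=\Big\{\sum_i\varphi_i\otimes w_i\ \Big|\ \sum_i(\psi\varphi_i)\cdot w_i=0\ \text{ for all }\psi\in k\mathcal C(E,X)\Big\},$$ and let $\mathbb S_{E,R}=L_{E,W}/J_{E,W}$. One has $\mathbb S_{E,R}(E)\cong\mathcal P_Ef_R$, where $w\in\mathcal P_Ef_R$ corresponds to the class of $\Delta_E\otimes w$. Let $T$ be a finite (nonempty) lattice. Let $F_T$ be the correspondence functor whose value at $X$ is the free $k$-module with basis the set of all maps $X\to T$, a correspondence $S\subseteq Y\times X$ acting by $(S\varphi)(y)=\bigvee_{(y,x)\in S}\varphi(x)$. Let $E$ be the set of join-irreducible elements of $T$ (the least element is not irreducible), $R$ the restriction to $E$ of the order of $T$, $R^{op}$ the opposite order, and $\iota:E\to T$ the inclusion. Let $H_T$ be the subfunctor of $F_T$ such that $H_T(X)$ is spanned by the maps $\varphi:X\to T$ with $E\not\subseteq\varphi(X)$. **Theorem.** (a) There is a unique morphism of correspondence functors $\Theta_T:F_T\to\mathbb S_{E,R^{op}}$ mapping $\iota\in F_T(E)$ to $f_{R^{op}}\in\mathbb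 S_{E,R^{op}}(E)\cong\mathcal P_Ef_{R^{op}}$. Moreover, $\Theta_T$ is surjective. (b) The subfunctor $H_T$ is contained in the kernel of $\Theta_T$. In particular, $\Theta_T$ factors uniquely through the quotient $F_T\to F_T/H_T$, and the induced morphism $\overline\Theta_T:F_T/H_T\to\mathbb S_{E,R^{op}}$ is surjective. -/

import Mathlib

open CategoryTheory TensorProduct

universe u v w

/-! ### Finite sets and correspondences -/

/-- The objects of the category of finite sets and correspondences: the finite sets. -/
structure FinCorr : Type (u + 1) where
  /-- The underlying set. -/
  carrier : Type u
  /-- The underlying set is finite. -/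
  [finite : Finite carrier]

namespace FinCorr

instance : CoeSort FinCorr.{u} (Type u) := ⟨carrier⟩

attribute [instance] FinCorr.finite

/-- Morphisms from `X` to `Y` are the correspondences, i.e. the subsets of `Y × X`; the composite
of `R : X ⟶ Y` and `S : Y ⟶ Z` is `S R = {(z, x) | ∃ y, (z, y) ∈ S ∧ (y, x) ∈ R}`. -/
instance : Category FinCorr.{u} where
  Hom X Y := SetRel Y X
  id _ := SetRel.id
  comp R S := SetRel.comp S R
  id_comp R := SetRel.comp_id R
  comp_id R := SetRel.id_comp R
  assoc R S T := (SetRel.comp_assoc T S R).symm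

end FinCorr

/-- The `k`-linearization `k𝒞` of the category of finite sets and correspondences. -/
abbrev LinCorr (k : Type v) : Type (u + 1) := Free k FinCorr.{u}

/-- The finite set underlying an object of `k𝒞` (the objects of `k𝒞` are the finite sets). -/
def LinCorr.toFin {k : Type v} (X : LinCorr.{u} k) : FinCorr.{u} := X

section

variable (k : Type v) [CommRing k]

/-- A correspondence `R ⊆ Y × X`, as a basis element of the free module `k𝒞(Y, X)` of morphisms
from `X` to `Y`. -/
noncomputable def relHom {X Y : FinCorr.{u}} (R : SetRel Y X) :
    (Free.of k X : LinCorr.{u} k) ⟶ Free.of k Y :=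
  (Free.embedding k FinCorr.{u}).map R

theorem relHom_id (X : FinCorr.{u}) :
    relHom k (SetRel.id : SetRel X X) = 𝟙 (Free.of k X : LinCorr.{u} k) := rfl

theorem relHom_comp {X Y Z : FinCorr.{u}} (R : SetRel Y X) (S : SetRel Z Y) :
    relHom k R ≫ relHom k S = relHom k (SetRel.comp S R) :=
  ((Free.embedding k FinCorr.{u}).map_comp (X := X) (Y := Y) (Z := Z) R S).symm

/-- Induction on morphisms of `k𝒞`: they are linear combinations of correspondences. -/
theorem LinCorr.hom_induction {X Y : FinCorr.{u}}
    {P : ((Free.of k X : LinCorr.{u} k) ⟶ Free.of k Y) → Prop}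
    (f : (Free.of k X : LinCorr.{u} k) ⟶ Free.of k Y)
    (zero : P 0) (add : ∀ f g, P f → P g → P (f + g))
    (smul : ∀ (c : k) (R : SetRel Y X), P (c • relHom k R)) : P f := by
  refine Finsupp.induction_linear (motive := P) f zero add (fun R c => ?_)
  have h : (c • relHom k (X := X) (Y := Y) R) = (Finsupp.single R c : _ →₀ k) := by
    change c • (Finsupp.single R 1 : _ →₀ k) = _
    rw [Finsupp.smul_single, smul_eq_mul, mul_one]
  exact Eq.mp (congrArg P h) (smul c R)

end

/-! ### Correspondence functors

A correspondence functor is a `k`-linear functor `LinCorr k ⥤ ModuleCat k`; a morphism of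
correspondence functors is a natural transformation. -/

section Subfunctors

variable {k : Type v} [CommRing k]

/-- A subfunctor of a functor from `k𝒞` to `k`-modules. -/
@[ext]
structure CorrSubfunctor (M : LinCorr.{u} k ⥤ ModuleCat.{w} k) where
  /-- The evaluation of the subfunctor. -/
  obj : ∀ X : LinCorr.{u} k, Submodule k (M.obj X)
  /-- The evaluations are stable under the action of morphisms. -/
  map_le : ∀ {X Y : LinCorr.{u} k} (f : X ⟶ Y), obj X ≤ (obj Y).comap (M.map f).hom

namespace CorrSubfunctor

variable {M M' : LinCorr.{u} k ⥤ ModuleCat.{w} k}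

instance : LE (CorrSubfunctor M) := ⟨fun N N' => ∀ X, N.obj X ≤ N'.obj X⟩

/-- The kernel of a morphism of functors. -/
def ker (θ : M ⟶ M') : CorrSubfunctor M where
  obj X := LinearMap.ker (θ.app X).hom
  map_le {X Y} f := by
    intro m hm
    rw [Submodule.mem_comap, LinearMap.mem_ker]
    rw [LinearMap.mem_ker] at hm
    have h := congrArg (fun g => g.hom m) (θ.naturality f)
    simp only [ModuleCat.hom_comp, LinearMap.comp_apply] at h
    rw [h, hm, map_zero]

/-- The quotient functor `M / N`. -/
noncomputable def quotient (N : CorrSubfunctor M) : LinCorr.{u} k ⥤ ModuleCat.{w} k where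
  obj X := ModuleCat.of k (M.obj X ⧸ N.obj X)
  map {X Y} f := ModuleCat.ofHom ((N.obj X).mapQ (N.obj Y) (M.map f).hom (N.map_le f))
  map_id X := by
    ext m
    simp
  map_comp f g := by
    ext m
    simp

/-- The canonical projection `M ⟶ M / N`. -/
noncomputable def proj (N : CorrSubfunctor M) : M ⟶ N.quotient where
  app X := ModuleCat.ofHom (N.obj X).mkQ
  naturality X Y f := by
    ext m
    rfl

instance (N : CorrSubfunctor M) [M.Additive] : N.quotient.Additive where
  map_add {X Y f g} := by
    refine ModuleCat.hom_ext (Submodule.linearMap_qext _ (LinearMap.ext fun m => ?_))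
    change (N.obj Y).mkQ ((M.map (f + g)).hom m) =
      (N.obj Y).mkQ ((M.map f).hom m) + (N.obj Y).mkQ ((M.map g).hom m)
    rw [M.map_add, ← map_add]
    rfl

instance (N : CorrSubfunctor M) [M.Linear k] : N.quotient.Linear k where
  map_smul {X Y} f c := by
    refine ModuleCat.hom_ext (Submodule.linearMap_qext _ (LinearMap.ext fun m => ?_))
    change (N.obj Y).mkQ ((M.map (c • f)).hom m) = c • (N.obj Y).mkQ ((M.map f).hom m)
    rw [M.map_smul, ← map_smul]
    rfl

end CorrSubfunctor

end Subfunctors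

/-! ### The functors `L_{E,W}`, `J_{E,W}` and `L_{E,W} / J_{E,W}`

The algebra `k𝒞(E, E)` is `End (Free.of k E)`, in which `a * b` is the composite `b ≫ a`. -/

section LFunctor

variable (k : Type v) [CommRing k] (E : FinCorr.{u})

/-- The algebra `k𝒞(E, E)` of all relations on `E`. -/
abbrev RelAlg : Type (max u v) := End (Free.of k E : LinCorr.{u} k)

variable (W : Type (max u v)) [AddCommGroup W] [Module k W]

variable {k} in
/-- The functoriality of `k𝒞(X, E) ⊗[k] W` in `X`. -/
noncomputable def tensorMap {X Y : LinCorr.{u} k} (g : X ⟶ Y) :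
    ((Free.of k E ⟶ X) ⊗[k] W) →ₗ[k] ((Free.of k E ⟶ Y) ⊗[k] W) :=
  LinearMap.rTensor W (Linear.rightComp k (Free.of k E) g)

variable {k} in
theorem tensorMap_tmul {X Y : LinCorr.{u} k} (g : X ⟶ Y) (φ : Free.of k E ⟶ X) (x : W) :
    tensorMap E W g (φ ⊗ₜ x) = (φ ≫ g) ⊗ₜ x := rfl

variable [Module (RelAlg k E) W]

/-- The submodule of `k𝒞(X, E) ⊗[k] W` spanned by the elements `φ a ⊗ w - φ ⊗ a w`, for
`a ∈ k𝒞(E, E)`. -/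
noncomputable def balancedRel (X : LinCorr.{u} k) :
    Submodule k ((Free.of k E ⟶ X) ⊗[k] W) :=
  Submodule.span k {t | ∃ (φ : Free.of k E ⟶ X) (a : RelAlg k E) (x : W),
    t = (a.asHom ≫ φ) ⊗ₜ[k] x - φ ⊗ₜ[k] (a • x)}

variable {k} in
theorem balancedRel_le {X Y : LinCorr.{u} k} (g : X ⟶ Y) :
    balancedRel k E W X ≤ (balancedRel k E W Y).comap (tensorMap E W g) := by
  refine Submodule.span_le.2 ?_
  rintro _ ⟨φ, a, x, rfl⟩
  refine Submodule.subset_span ⟨φ ≫ g, a, x, ?_⟩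
  rw [map_sub, tensorMap_tmul, tensorMap_tmul, Category.assoc]

/-- The functor `L_{E,W} = k𝒞(-, E) ⊗_{k𝒞(E, E)} W`. The tensor product over the noncommutative
algebra `k𝒞(E, E)` is the quotient of the tensor product over `k` by `balancedRel`. -/
noncomputable def LFunctor : LinCorr.{u} k ⥤ ModuleCat.{max u v} k where
  obj X := ModuleCat.of k (((Free.of k E ⟶ X) ⊗[k] W) ⧸ balancedRel k E W X)
  map {X Y} g := ModuleCat.ofHom
    ((balancedRel k E W X).mapQ (balancedRel k E W Y) (tensorMap E W g) (balancedRel_le E W g))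
  map_id X := by
    refine ModuleCat.hom_ext (Submodule.linearMap_qext _ (TensorProduct.ext' fun φ x => ?_))
    change (balancedRel k E W X).mkQ ((φ ≫ 𝟙 X) ⊗ₜ x) = (balancedRel k E W X).mkQ (φ ⊗ₜ x)
    rw [Category.comp_id]
  map_comp {X Y Z} f g := by
    refine ModuleCat.hom_ext (Submodule.linearMap_qext _ (TensorProduct.ext' fun φ x => ?_))
    change (balancedRel k E W Z).mkQ ((φ ≫ f ≫ g) ⊗ₜ x) =
      (balancedRel k E W Z).mkQ (((φ ≫ f) ≫ g) ⊗ₜ x)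
    rw [Category.assoc]

variable {k} in
/-- The element `φ ⊗ x` of `L_{E,W}(X)`. -/
noncomputable def ltmul {X : LinCorr.{u} k} (φ : Free.of k E ⟶ X) (x : W) :
    (LFunctor k E W).obj X :=
  (balancedRel k E W X).mkQ (φ ⊗ₜ[k] x)

variable {k} in
theorem ltmul_comp {X : LinCorr.{u} k} (φ : Free.of k E ⟶ X) (a : RelAlg k E) (x : W) :
    ltmul E W (a.asHom ≫ φ) x = ltmul E W φ (a • x) := by
  refine (Submodule.Quotient.eq _).2 (Submodule.subset_span ⟨φ, a, x, rfl⟩)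

variable {k} in
theorem LFunctor_map_ltmul {X Y : LinCorr.{u} k} (g : X ⟶ Y) (φ : Free.of k E ⟶ X) (x : W) :
    ((LFunctor k E W).map g).hom (ltmul E W φ x) = ltmul E W (φ ≫ g) x := rfl

variable {k E W} in
theorem LFunctor_hom_ext {X : LinCorr.{u} k} {N : Type*} [AddCommGroup N] [Module k N]
    {f g : (LFunctor k E W).obj X →ₗ[k] N}
    (h : ∀ φ x, f (ltmul E W φ x) = g (ltmul E W φ x)) : f = g :=
  Submodule.linearMap_qext _ (TensorProduct.ext' fun φ x => h φ x)

instance : (LFunctor k E W).Additive where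
  map_add {X Y f g} := by
    refine ModuleCat.hom_ext (LFunctor_hom_ext fun φ x => ?_)
    change (balancedRel k E W Y).mkQ ((φ ≫ (f + g)) ⊗ₜ x) =
      (balancedRel k E W Y).mkQ ((φ ≫ f) ⊗ₜ x) + (balancedRel k E W Y).mkQ ((φ ≫ g) ⊗ₜ x)
    rw [Preadditive.comp_add, TensorProduct.add_tmul, map_add]

instance : (LFunctor k E W).Linear k where
  map_smul {X Y} f c := by
    refine ModuleCat.hom_ext (LFunctor_hom_ext fun φ x => ?_)
    change (balancedRel k E W Y).mkQ ((φ ≫ (c • f)) ⊗ₜ x) =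
      c • (balancedRel k E W Y).mkQ ((φ ≫ f) ⊗ₜ x)
    rw [Linear.comp_smul, ← map_smul, TensorProduct.smul_tmul']

variable [IsScalarTower k (RelAlg k E) W]

variable {k} in
/-- For `ψ ∈ k𝒞(E, X)`, the linear map `L_{E,W}(X) → W` with `φ ⊗ x ↦ (ψ φ) x`. -/
noncomputable def LPairing {X : LinCorr.{u} k} (ψ : X ⟶ Free.of k E) :
    (LFunctor k E W).obj X →ₗ[k] W :=
  (balancedRel k E W X).liftQ
    (TensorProduct.lift ((Algebra.lsmul k k W : RelAlg k E →ₐ[k] Module.End k W).toLinearMap ∘ₗ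
      (Linear.rightComp k (Free.of k E) ψ :
        (Free.of k E ⟶ X) →ₗ[k] RelAlg k E))) (by
    refine Submodule.span_le.2 ?_
    rintro _ ⟨φ, a, x, rfl⟩
    change TensorProduct.lift _ _ = 0
    rw [map_sub, TensorProduct.lift.tmul, TensorProduct.lift.tmul, sub_eq_zero]
    change End.of ((a.asHom ≫ φ) ≫ ψ) • x = End.of (φ ≫ ψ) • (a • x)
    rw [Category.assoc, ← mul_smul]
    rfl)

variable {k} in
theorem LPairing_ltmul {X : LinCorr.{u} k} (ψ : X ⟶ Free.of k E) (φ : Free.of k E ⟶ X) (x : W) :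
    LPairing E W ψ (ltmul E W φ x) = End.of (φ ≫ ψ) • x := rfl

/-- The subfunctor `J_{E,W}` of `L_{E,W}`: the elements `∑ φᵢ ⊗ xᵢ` of `L_{E,W}(X)` such that
`∑ (ψ φᵢ) xᵢ = 0` for all `ψ ∈ k𝒞(E, X)`. -/
noncomputable def JSubfunctor : CorrSubfunctor (LFunctor k E W) where
  obj X := ⨅ ψ : X ⟶ Free.of k E, LinearMap.ker (LPairing E W ψ)
  map_le {X Y} f := by
    intro m hm
    simp only [Submodule.mem_comap, Submodule.mem_iInf, LinearMap.mem_ker] at hm ⊢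
    intro ψ
    have h : LPairing E W ψ ∘ₗ ((LFunctor k E W).map f).hom = LPairing E W (f ≫ ψ) := by
      refine LFunctor_hom_ext fun φ x => ?_
      rw [LinearMap.comp_apply, LFunctor_map_ltmul, LPairing_ltmul, LPairing_ltmul,
        Category.assoc]
    rw [← LinearMap.comp_apply, h]
    exact hm _

/-- The functor `L_{E,W} / J_{E,W}`. -/
noncomputable def LJQuotient : LinCorr.{u} k ⥤ ModuleCat.{max u v} k :=
  (JSubfunctor k E W).quotient

noncomputable instance : (LJQuotient k E W).Additive :=
  inferInstanceAs (JSubfunctor k E W).quotient.Additive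

noncomputable instance : (LJQuotient k E W).Linear k :=
  inferInstanceAs ((JSubfunctor k E W).quotient.Linear k)

/-- The canonical isomorphism `W ≅ (L_{E,W} / J_{E,W})(E)`, sending `x` to the class of
`Δ_E ⊗ x`; its inverse sends the class of `φ ⊗ x` to `φ x`. -/
noncomputable def evalEquiv : W ≃ₗ[k] (LJQuotient k E W).obj (Free.of k E) :=
  LinearEquiv.ofLinearMap
    (((JSubfunctor k E W).obj (Free.of k E)).mkQ ∘ₗ (balancedRel k E W (Free.of k E)).mkQ ∘ₗ
      TensorProduct.mk k (Free.of k E ⟶ Free.of k E) W (𝟙 (Free.of k E)))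
    (((JSubfunctor k E W).obj (Free.of k E)).liftQ (LPairing E W (𝟙 (Free.of k E))) (iInf_le _ _))
    (by
      refine Submodule.linearMap_qext _ (LFunctor_hom_ext fun φ x => ?_)
      change ((JSubfunctor k E W).obj (Free.of k E)).mkQ
        (ltmul E W (𝟙 (Free.of k E)) (LPairing E W (𝟙 (Free.of k E)) (ltmul E W φ x))) =
          ((JSubfunctor k E W).obj (Free.of k E)).mkQ (ltmul E W φ x)
      rw [LPairing_ltmul, ← ltmul_comp, Category.comp_id, Category.comp_id])
    (by
      refine LinearMap.ext fun x => ?_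
      change LPairing E W (𝟙 (Free.of k E)) (ltmul E W (𝟙 (Free.of k E)) x) = x
      rw [LPairing_ltmul, Category.comp_id]
      exact one_smul (RelAlg k E) x)

theorem evalEquiv_smul (a : RelAlg k E) (x : W) :
    evalEquiv k E W (a • x) = ((LJQuotient k E W).map a.asHom).hom (evalEquiv k E W x) := by
  change ((JSubfunctor k E W).obj _).mkQ (ltmul E W (𝟙 (Free.of k E)) (a • x)) =
    ((JSubfunctor k E W).obj _).mkQ (ltmul E W (𝟙 (Free.of k E) ≫ a.asHom) x)
  rw [← ltmul_comp, Category.comp_id, Category.id_comp]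

end LFunctor

/-! ### Orders, the algebra of permuted orders, and the fundamental functors -/

section Fundamental

/-- The (partial) orders on a set, as relations, ordered by inclusion. -/
def OrderOn (E : Type u) : Type u :=
  {R : SetRel E E // (∀ a, (a, a) ∈ R) ∧ (∀ a b, (a, b) ∈ R → (b, a) ∈ R → a = b) ∧
    ∀ a b c, (a, b) ∈ R → (b, c) ∈ R → (a, c) ∈ R}

namespace OrderOn

variable {E : Type u}

instance : PartialOrder (OrderOn E) := Subtype.partialOrder _

instance [Finite E] : Finite (OrderOn E) := Subtype.finite

/-- The opposite order. -/
def op (R : OrderOn E) : OrderOn E :=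
  ⟨R.1.inv, fun a => R.2.1 a, fun a b h h' => R.2.2.1 a b h' h,
    fun a b c h h' => R.2.2.2 c b a h' h⟩

noncomputable instance [Finite E] : Fintype (OrderOn E) := Fintype.ofFinite _

open Classical in
noncomputable instance [Finite E] : LocallyFiniteOrder (OrderOn E) :=
  Fintype.toLocallyFiniteOrder

open Classical in
/-- The Möbius function of the poset of orders on `E`, ordered by inclusion. -/
noncomputable def moebius [Finite E] (R S : OrderOn E) : ℤ := IncidenceAlgebra.mu ℤ R S

end OrderOn

/-- The transitive closure of a relation. -/
def SetRel.transClosure {E : Type u} (S : SetRel E E) : SetRel E E :=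
  {p | Relation.TransGen (fun a b => (a, b) ∈ S) p.1 p.2}

/-- A relation on `E` is inessential if it factors through a set of smaller cardinality. -/
def Inessential {E : FinCorr.{u}} (Q : SetRel E E) : Prop :=
  ∃ (Y : FinCorr.{u}) (A : SetRel E Y) (B : SetRel Y E),
    Nat.card Y < Nat.card E ∧ Q = SetRel.comp A B

variable (k : Type v) [CommRing k] (E : FinCorr.{u})

/-- The relations that define the algebra of permuted orders as a quotient of `k𝒞(E, E)`:
inessential relations become zero, which gives the essential algebra, and every reflexive relation
is identified with its transitive closure. -/
inductive PermutedOrderRel : RelAlg k E → RelAlg k E → Prop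
  | inessential (Q : SetRel E E) : Inessential Q → PermutedOrderRel (End.of (relHom k Q)) 0
  | closure (S : SetRel E E) : (∀ a, (a, a) ∈ S) →
      PermutedOrderRel (End.of (relHom k S)) (End.of (relHom k S.transClosure))

/-- The algebra `𝒫_E` of permuted orders. -/
def PermutedOrderAlg : Type (max u v) := RingQuot (PermutedOrderRel k E)

namespace PermutedOrderAlg

noncomputable instance : Ring (PermutedOrderAlg k E) :=
  inferInstanceAs (Ring (RingQuot (PermutedOrderRel k E)))

noncomputable instance : Algebra k (PermutedOrderAlg k E) :=
  inferInstanceAs (Algebra k (RingQuot (PermutedOrderRel k E)))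

/-- The quotient map `k𝒞(E, E) → 𝒫_E`. -/
noncomputable def mk : RelAlg k E →ₐ[k] PermutedOrderAlg k E :=
  RingQuot.mkAlgHom k (PermutedOrderRel k E)

noncomputable instance : Module (RelAlg k E) (PermutedOrderAlg k E) :=
  Module.compHom _ (mk k E).toRingHom

theorem smul_def (a : RelAlg k E) (p : PermutedOrderAlg k E) : a • p = mk k E a * p := rfl

instance : IsScalarTower k (RelAlg k E) (PermutedOrderAlg k E) where
  smul_assoc c a p := by rw [smul_def, smul_def, map_smul, smul_mul_assoc]

instance : IsScalarTower (RelAlg k E) (PermutedOrderAlg k E) (PermutedOrderAlg k E) where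
  smul_assoc a p q := by simp only [smul_def, smul_eq_mul, mul_assoc]

end PermutedOrderAlg

/-- The idempotent `f_R = ∑_{S ⊇ R} μ(R, S) S` of `𝒫_E`, where `S` runs over the orders
containing `R`; equivalently, the `f_S` are the elements with `R = ∑_{S ⊇ R} f_S` for all `R`. -/
noncomputable def orderIdem (R : OrderOn E) : PermutedOrderAlg k E :=
  ∑ S : OrderOn E, R.moebius S • PermutedOrderAlg.mk k E (End.of (relHom k S.1))

/-- The fundamental module `𝒫_E f_R`: the left ideal of `𝒫_E` generated by `f_R`. -/
noncomputable abbrev FundamentalModule (R : OrderOn E) : Type (max u v) :=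
  ↥(Ideal.span {orderIdem k E R} : Ideal (PermutedOrderAlg k E))

/-- The element `f_R` of the fundamental module. -/
noncomputable def fundamentalGen (R : OrderOn E) : FundamentalModule k E R :=
  ⟨orderIdem k E R, Ideal.subset_span rfl⟩

/-- The fundamental functor `𝕊_{E,R} = L_{E,W} / J_{E,W}` for `W = 𝒫_E f_R`. -/
noncomputable def fundamentalFunctor (R : OrderOn E) : LinCorr.{u} k ⥤ ModuleCat.{max u v} k :=
  LJQuotient k E (FundamentalModule k E R)

instance (R : OrderOn E) : (fundamentalFunctor k E R).Additive :=
  inferInstanceAs (LJQuotient k E (FundamentalModule k E R)).Additive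

instance (R : OrderOn E) : (fundamentalFunctor k E R).Linear k :=
  inferInstanceAs ((LJQuotient k E (FundamentalModule k E R)).Linear k)

/-- The canonical isomorphism `𝒫_E f_R ≅ 𝕊_{E,R}(E)`. -/
noncomputable def fundamentalEval (R : OrderOn E) :
    FundamentalModule k E R ≃ₗ[k] (fundamentalFunctor k E R).obj (Free.of k E) :=
  evalEquiv k E (FundamentalModule k E R)

end Fundamental

/-! ### The functor associated to a finite lattice -/

section LatticeFunctor

variable (T : Type u) [Lattice T] [BoundedOrder T]

variable {T} in
/-- The action of a correspondence `R ⊆ Y × X` on maps `X → T`: `(R φ)(y)` is the join of the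
`φ x` with `(y, x) ∈ R`. -/
noncomputable def corrAct {X Y : FinCorr.{u}} (R : SetRel Y X) (φ : X → T) : Y → T :=
  fun y => (Set.toFinite {x : X | (y, x) ∈ R}).toFinset.sup φ

theorem corrAct_id (X : FinCorr.{u}) (φ : X → T) : corrAct (SetRel.id : SetRel X X) φ = φ := by
  funext y
  refine le_antisymm (Finset.sup_le fun x hx => ?_) (Finset.le_sup (f := φ) ?_)
  · have h : x = y := by simpa using hx
    rw [h]
  · simp

theorem corrAct_comp {X Y Z : FinCorr.{u}} (R : SetRel Y X) (S : SetRel Z Y) (φ : X → T) :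
    corrAct (SetRel.comp S R) φ = corrAct S (corrAct R φ) := by
  funext z
  refine le_antisymm (Finset.sup_le fun x hx => ?_) (Finset.sup_le fun y hy =>
    Finset.sup_le fun x hx => Finset.le_sup (f := φ) ?_)
  · obtain ⟨y, hy, hx⟩ : ∃ y, (z, y) ∈ S ∧ (y, x) ∈ R := by simpa using hx
    refine le_trans (Finset.le_sup (f := φ) (b := x) ?_)
      (Finset.le_sup (f := corrAct R φ) (b := y) ?_)
    · simpa using hx
    · simpa using hy
  · have hy' : (z, y) ∈ S := by simpa using hy
    have hx' : (y, x) ∈ R := by simpa using hx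
    have : (z, x) ∈ SetRel.comp S R := ⟨y, hy', hx'⟩
    simpa using this

variable (k : Type v) [CommRing k]

/-- The `k`-linear extension of the action of correspondences to `k𝒞(Y, X)`. -/
noncomputable def latticeMap (X Y : FinCorr.{u}) :
    ((Free.of k X : LinCorr.{u} k) ⟶ Free.of k Y) →ₗ[k] ((X → T) →₀ k) →ₗ[k] ((Y → T) →₀ k) :=
  Finsupp.linearCombination k fun R : SetRel Y X => Finsupp.lmapDomain k k (corrAct (T := T) R)

theorem latticeMap_relHom {X Y : FinCorr.{u}} (R : SetRel Y X) :
    latticeMap T k X Y (relHom k R) = Finsupp.lmapDomain k k (corrAct R) := by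
  refine (Finsupp.linearCombination_single k (1 : k) R).trans (one_smul k _)

theorem latticeMap_id (X : FinCorr.{u}) : latticeMap T k X X (𝟙 _) = LinearMap.id := by
  rw [← relHom_id, latticeMap_relHom]
  have : corrAct (T := T) (SetRel.id : SetRel X X) = id := funext (corrAct_id T X)
  rw [this, Finsupp.lmapDomain_id]

theorem latticeMap_comp {X Y Z : FinCorr.{u}} (f : (Free.of k X : LinCorr.{u} k) ⟶ Free.of k Y)
    (g : (Free.of k Y : LinCorr.{u} k) ⟶ Free.of k Z) :
    latticeMap T k X Z (f ≫ g) = latticeMap T k Y Z g ∘ₗ latticeMap T k X Y f := by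
  refine LinCorr.hom_induction k
    (P := fun f => latticeMap T k X Z (f ≫ g) = latticeMap T k Y Z g ∘ₗ latticeMap T k X Y f)
    f ?_ ?_ ?_
  · rw [Limits.zero_comp, map_zero, map_zero, LinearMap.comp_zero]
  · intro f f' h h'
    rw [Preadditive.add_comp, map_add, map_add, h, h', LinearMap.comp_add]
  intro c R
  refine LinCorr.hom_induction k
    (P := fun g => latticeMap T k X Z ((c • relHom k R) ≫ g) =
      latticeMap T k Y Z g ∘ₗ latticeMap T k X Y (c • relHom k R)) g ?_ ?_ ?_
  · rw [Limits.comp_zero, map_zero, map_zero, LinearMap.zero_comp]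
  · intro g g' h h'
    rw [Preadditive.comp_add, map_add, map_add, h, h', LinearMap.add_comp]
  intro d S
  rw [Linear.smul_comp, Linear.comp_smul, map_smul, map_smul, map_smul, map_smul,
    LinearMap.smul_comp, LinearMap.comp_smul, smul_comm]
  refine congrArg (fun z => d • c • z) ?_
  refine (congrArg _ (relHom_comp k R S)).trans ?_
  refine (latticeMap_relHom T k _).trans ?_
  refine Eq.trans ?_ (congrArg₂ LinearMap.comp (latticeMap_relHom T k S)
    (latticeMap_relHom T k R)).symm
  rw [← Finsupp.lmapDomain_comp]
  exact congrArg _ (funext fun φ => corrAct_comp T R S φ)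

/-- The correspondence functor `F_T`: its value at `X` is the free module with basis the set of
maps `X → T`. -/
noncomputable def latticeFunctor : LinCorr.{u} k ⥤ ModuleCat.{max u v} k where
  obj X := ModuleCat.of k ((X.toFin → T) →₀ k)
  map {X Y} f := ModuleCat.ofHom (latticeMap T k X.toFin Y.toFin f)
  map_id X := congrArg ModuleCat.ofHom (latticeMap_id T k X.toFin)
  map_comp {X Y Z} f g := congrArg ModuleCat.ofHom
    (latticeMap_comp T k (X := X.toFin) (Y := Y.toFin) (Z := Z.toFin) f g)

instance : (latticeFunctor T k).Additive where
  map_add {X Y f g} := congrArg ModuleCat.ofHom (map_add (latticeMap T k X.toFin Y.toFin) f g)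

instance : (latticeFunctor T k).Linear k where
  map_smul {X Y} f c := congrArg ModuleCat.ofHom (map_smul (latticeMap T k X.toFin Y.toFin) c f)

variable {T} in
/-- A map `φ : X → T`, as a basis element of `F_T(X)`. -/
noncomputable def latticeBasis {X : FinCorr.{u}} (φ : X → T) :
    (latticeFunctor T k).obj (Free.of k X) :=
  (Finsupp.single φ 1 : (X → T) →₀ k)

/-- The module `H_T(X)`, generated by the maps `φ : X → T` whose image does not contain all the
irreducible elements of `T`. -/
noncomputable def latticeHObj (X : FinCorr.{u}) : Submodule k ((X → T) →₀ k) :=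
  Submodule.span k {m | ∃ φ : X → T, ¬ {e : T | SupIrred e} ⊆ Set.range φ ∧
    m = Finsupp.single φ 1}

theorem latticeHObj_le {X Y : FinCorr.{u}} (f : (Free.of k X : LinCorr.{u} k) ⟶ Free.of k Y) :
    latticeHObj T k X ≤ (latticeHObj T k Y).comap (latticeMap T k X Y f) := by
  refine Submodule.span_le.2 ?_
  rintro _ ⟨φ, hφ, rfl⟩
  change latticeMap T k X Y f (Finsupp.single φ 1) ∈ latticeHObj T k Y
  refine LinCorr.hom_induction k
    (P := fun f => latticeMap T k X Y f (Finsupp.single φ 1) ∈ latticeHObj T k Y) f ?_ ?_ ?_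
  · rw [map_zero]
    exact Submodule.zero_mem _
  · intro f g hf hg
    rw [map_add]
    exact Submodule.add_mem _ hf hg
  · intro c R
    rw [map_smul]
    refine Submodule.smul_mem _ c (Submodule.subset_span ⟨corrAct R φ, fun h => hφ ?_, ?_⟩)
    · intro e he
      obtain ⟨y, hy⟩ := h he
      obtain ⟨x, -, hx⟩ := SupIrred.finset_sup_eq he hy
      exact ⟨x, hx⟩
    · rw [latticeMap_relHom, Finsupp.lmapDomain_apply, Finsupp.mapDomain_single]

/-- The subfunctor `H_T` of `F_T`. -/
noncomputable def latticeH : CorrSubfunctor (latticeFunctor T k) where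
  obj X := latticeHObj T k X.toFin
  map_le {X Y} f := latticeHObj_le T k (X := X.toFin) (Y := Y.toFin) f

variable [Finite T]

/-- The finite set `E` of irreducible elements of `T`. -/
def irrSet : FinCorr.{u} where
  carrier := {e : T // SupIrred e}

/-- The order `R` on the set `E` of irreducible elements of `T`, which makes it a full subposet
of `T`. -/
def irrOrder : OrderOn (irrSet T) :=
  ⟨{p | p.1.1 ≤ p.2.1}, fun a => le_refl a.1, fun _ _ h h' => Subtype.ext (le_antisymm h h'),
    fun _ _ _ h h' => le_trans (α := T) h h'⟩

/-- The inclusion `ι : E → T` of the irreducible elements. -/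
def irrIncl : irrSet T → T := Subtype.val

end LatticeFunctor

/-! Everything rests on how relations multiply `f_R` in `𝒫_E`. A reflexive relation `S` fixes `f_R`
if `S ⊆ R` and kills it otherwise (`relClass_mul_orderIdem_of_subset`,
`relClass_mul_orderIdem_of_not_subset`). A general relation `Q` either contains no permutation, and
is then inessential by Hall's theorem, or is a permutation `g` times a reflexive relation. So `Q
f_R` is either `g f_R` or zero.

For `Rᵒᵖ` this becomes a statement about the lattice. The nonzero case occurs exactly when `g e` is
the largest element of row `e` of `Q` for every `e`, that is, when `Q ι = ι ∘ g`
(`corrAct_irrIncl_eq_iff`). Hence `Q f_{Rᵒᵖ}` depends only on `Q ι`. Since elements of `L_{E,W}` are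
identified modulo `J_{E,W}` when all relations back to `E` give the same result, the class of `A ⊗
f_{Rᵒᵖ}` depends only on `A ι` (`fundamentalClass_lowerRel_corrAct`), so `A ι ↦ A ⊗ f_{Rᵒᵖ}` is well
defined and natural.

Each `φ` is `A ι` with `A = {(x, e) | e ≤ φ x}`, because elements of `T` are joins of irreducibles.
So `ι` generates `F_T`, which gives uniqueness, and `f_{Rᵒᵖ}` generates the target, which gives
surjectivity. If `φ` misses an irreducible, so does every `S φ`; then `S φ` is never of the form `ι
∘ g`, and `φ` maps to zero. -/

/-! ### Inessential relations -/

section Essential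

variable {E : FinCorr.{u}}

/-- A relation that contains no permutation is inessential. -/
theorem Inessential.of_forall_perm {Q : SetRel E E}
    (h : ∀ g : Equiv.Perm E, ∃ e, (e, g e) ∉ Q) : Inessential Q := by
  classical
  have := Fintype.ofFinite E
  -- By Hall's marriage theorem, a system of distinct representatives for the rows of `Q` would be a
  -- permutation contained in `Q`.
  have hall : ¬ ∀ s : Finset E, s.card ≤ (s.biUnion fun e => {x | (e, x) ∈ Q}.toFinset).card := by
    rw [Finset.all_card_le_biUnion_card_iff_exists_injective]
    rintro ⟨g, hg, hQ⟩
    obtain ⟨e, he⟩ := h (Equiv.ofBijective g (Finite.injective_iff_bijective.1 hg))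
    exact he (by simpa using hQ e)
  push Not at hall
  obtain ⟨s, hs⟩ := hall
  set N : Finset E := s.biUnion fun e => {x | (e, x) ∈ Q}.toFinset with hN
  -- The rows in `s` only meet the smaller set `N`. Rows outside `s` pass through their own index
  -- and those in `s` through their column, so `|E| - |s| + |N|` points suffice.
  refine ⟨⟨{e // e ∈ sᶜ} ⊕ {e // e ∈ N}⟩,
    {p | p.2.elim (fun y => p.1 = y.1) (fun y => p.1 ∈ s ∧ (p.1, y.1) ∈ Q)},
    {p | p.1.elim (fun y => (y.1, p.2) ∈ Q) (fun y => y.1 = p.2)}, ?_, ?_⟩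
  · change Nat.card ({e // e ∈ sᶜ} ⊕ {e // e ∈ N}) < Nat.card E
    rw [Nat.card_sum, Nat.card_eq_fintype_card, Nat.card_eq_fintype_card,
      Nat.card_eq_fintype_card, Fintype.card_coe, Fintype.card_coe, Finset.card_compl]
    have := s.card_le_univ
    omega
  · ext ⟨a, b⟩
    constructor
    · intro hab
      by_cases ha : a ∈ s
      · exact ⟨Sum.inr ⟨b, Finset.mem_biUnion.2 ⟨a, ha, by simpa using hab⟩⟩, ⟨ha, hab⟩, rfl⟩
      · exact ⟨Sum.inl ⟨a, Finset.mem_compl.2 ha⟩, rfl, hab⟩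
    · rintro ⟨y | y, h₁, h₂⟩
      · obtain rfl : a = y.1 := h₁
        exact h₂
      · obtain rfl : y.1 = b := h₂
        exact h₁.2

/-- A preorder which is not antisymmetric is inessential. -/
theorem Inessential.of_not_antisymm {Q : SetRel E E} (hrefl : ∀ a, (a, a) ∈ Q)
    (htrans : ∀ a b c, (a, b) ∈ Q → (b, c) ∈ Q → (a, c) ∈ Q) {a b : E}
    (hab : (a, b) ∈ Q) (hba : (b, a) ∈ Q) (hne : a ≠ b) : Inessential Q := by
  -- The point `b` is redundant, as `a` is equivalent to it in the preorder.
  refine ⟨⟨{x : E // x ≠ b}⟩, {p | (p.1, p.2.1) ∈ Q}, {p | (p.1.1, p.2) ∈ Q}, ?_, ?_⟩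
  · exact Finite.card_subtype_lt (p := fun x : E => x ≠ b) (x := b) (by simp)
  · ext ⟨x, z⟩
    constructor
    · intro hxz
      by_cases hx : x = b
      · subst hx
        exact ⟨⟨a, hne⟩, hba, htrans _ _ _ hab hxz⟩
      · exact ⟨⟨x, hx⟩, hrefl x, hxz⟩
    · rintro ⟨y, h₁, h₂⟩
      exact htrans _ _ _ h₁ h₂

end Essential

/-! ### The action of relations on the idempotents `f_R` -/

section Idempotents

variable (k : Type v) [CommRing k] {E : FinCorr.{u}}

/-- The class of a relation in the algebra of permuted orders. -/
noncomputable def relClass (Q : SetRel E E) : PermutedOrderAlg k E :=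
  PermutedOrderAlg.mk k E (End.of (relHom k Q))

theorem relClass_comp (A B : SetRel E E) :
    relClass k (SetRel.comp A B) = relClass k A * relClass k B := by
  unfold relClass
  rw [← map_mul, ← relHom_comp]
  rfl

theorem relClass_eq_zero {Q : SetRel E E} (h : Inessential Q) : relClass k Q = 0 :=
  (RingQuot.mkAlgHom_rel k (PermutedOrderRel.inessential Q h)).trans (map_zero _)

theorem relClass_transClosure {S : SetRel E E} (h : ∀ a, (a, a) ∈ S) :
    relClass k S.transClosure = relClass k S :=
  (RingQuot.mkAlgHom_rel k (PermutedOrderRel.closure S h)).symm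

/-- This is why `orderIdem` may sum over all orders rather than only those containing `R`. -/
theorem OrderOn.moebius_eq_zero {R S : OrderOn E} (h : ¬ R ≤ S) : R.moebius S = 0 :=
  IncidenceAlgebra.apply_eq_zero_of_not_le h _

open Classical in
/-- Möbius inversion: the class of an order `R` is the sum of the `f_S` for `S ⊇ R`. -/
theorem sum_orderIdem (R : OrderOn E) :
    ∑ U : OrderOn E with R ≤ U, orderIdem k E U = relClass k R.1 := by
  unfold orderIdem
  rw [Finset.sum_comm]
  -- The coefficient of `S` after exchanging the sums; only the interval from `R` to `S`
  -- contributes.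
  have h (S : OrderOn E) : ∑ U : OrderOn E with R ≤ U, U.moebius S = if R = S then 1 else 0 := by
    rw [← IncidenceAlgebra.sum_Icc_mu_left R S]
    refine (Finset.sum_subset (fun U hU => ?_) fun U _ hU => ?_).symm
    · simpa using (Finset.mem_Icc.1 hU).1
    · refine OrderOn.moebius_eq_zero fun hUS => hU (Finset.mem_Icc.2 ⟨?_, hUS⟩)
      simp_all
  simp_rw [← Finset.sum_smul, h, ite_smul, one_smul, zero_smul]
  rw [Finset.sum_ite_eq]
  simp [relClass]

/-- Each order `U ⊇ R` in the expansion of `f_R` absorbs `S`: transitivity gives `S U ⊆ U`, and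
reflexivity of `S` gives the converse. -/
theorem relClass_mul_orderIdem_of_subset {S : SetRel E E} (hrefl : ∀ a, (a, a) ∈ S)
    {R : OrderOn E} (h : S ⊆ R.1) : relClass k S * orderIdem k E R = orderIdem k E R := by
  unfold orderIdem
  rw [Finset.mul_sum]
  refine Finset.sum_congr rfl fun U _ => ?_
  by_cases hU : R ≤ U
  · rw [mul_smul_comm]
    change _ • (relClass k S * relClass k U.1) = _ • relClass k U.1
    rw [← relClass_comp]
    congr 2
    ext ⟨a, c⟩
    exact ⟨fun ⟨b, hab, hbc⟩ => U.2.2.2 a b c (hU (h hab)) hbc, fun hac => ⟨a, hrefl a, hac⟩⟩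
  · rw [OrderOn.moebius_eq_zero hU, zero_smul, mul_zero]

/-- A reflexive relation times an order is the class of an order if there is an order containing
both, and zero otherwise. -/
theorem relClass_mul_relClass_order {S : SetRel E E} (hrefl : ∀ a, (a, a) ∈ S) (R : OrderOn E) :
    (∃ V : OrderOn E, (∀ U : OrderOn E, V ≤ U ↔ S ⊆ U.1 ∧ R ≤ U) ∧
      relClass k S * relClass k R.1 = relClass k V.1) ∨
    ((∀ U : OrderOn E, ¬ (S ⊆ U.1 ∧ R ≤ U)) ∧ relClass k S * relClass k R.1 = 0) := by
  -- `C` is the preorder generated by `S` and `R`. It represents the product in `𝒫_E`, and is either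
  -- the least order containing both or inessential.
  set C : SetRel E E := (SetRel.comp S R.1).transClosure with hC
  have hbase : ∀ p, p ∈ SetRel.comp S R.1 → p ∈ C := fun p hp => Relation.TransGen.single hp
  have hprod : relClass k S * relClass k R.1 = relClass k C := by
    rw [← relClass_comp, hC, relClass_transClosure]
    exact fun a => ⟨a, hrefl a, R.2.1 a⟩
  have hCrefl : ∀ a, (a, a) ∈ C := fun a => hbase _ ⟨a, hrefl a, R.2.1 a⟩
  have hCtrans : ∀ a b c, (a, b) ∈ C → (b, c) ∈ C → (a, c) ∈ C :=
    fun _ _ _ h h' => Relation.TransGen.trans h h'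
  have hle (U : OrderOn E) : C ⊆ U.1 ↔ S ⊆ U.1 ∧ R ≤ U := by
    constructor
    · exact fun h => ⟨fun p hp => h (hbase _ ⟨p.2, hp, R.2.1 _⟩),
        fun p hp => h (hbase _ ⟨p.1, hrefl _, hp⟩)⟩
    · rintro ⟨hS, hR⟩ ⟨a, b⟩ hab
      change Relation.TransGen _ a b at hab
      induction hab with
      | single h =>
        obtain ⟨y, h₁, h₂⟩ := h
        exact U.2.2.2 _ _ _ (hS h₁) (hR h₂)
      | tail _ h ih =>
        obtain ⟨y, h₁, h₂⟩ := h
        exact U.2.2.2 _ _ _ ih (U.2.2.2 _ _ _ (hS h₁) (hR h₂))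
  by_cases hanti : ∀ a b, (a, b) ∈ C → (b, a) ∈ C → a = b
  · exact Or.inl ⟨⟨C, hCrefl, hanti, hCtrans⟩, hle, hprod⟩
  · push Not at hanti
    obtain ⟨a, b, hab, hba, hne⟩ := hanti
    refine Or.inr ⟨fun U hU => ?_, ?_⟩
    · exact hne (U.2.2.1 a b ((hle U).2 hU hab) ((hle U).2 hU hba))
    · rw [hprod, relClass_eq_zero k (.of_not_antisymm hCrefl hCtrans hab hba hne)]

-- Induction from larger orders to smaller ones. Möbius inversion gives `S R = S f_R + ∑_{U ⊋ R} S
-- f_U`, and by induction the last sum keeps just the `f_U` with `S ⊆ U`. The product `S R` already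
-- equals that sum, so nothing is left for `S f_R`.
open Classical in
theorem relClass_mul_orderIdem_of_not_subset {S : SetRel E E} (hrefl : ∀ a, (a, a) ∈ S)
    (R : OrderOn E) (h : ¬ S ⊆ R.1) : relClass k S * orderIdem k E R = 0 := by
  induction R using WellFoundedGT.induction with
  | ind R ih =>
  have hsum : relClass k S * relClass k R.1 = relClass k S * orderIdem k E R +
      ∑ U : OrderOn E with S ⊆ U.1 ∧ R ≤ U, orderIdem k E U := by
    rw [← sum_orderIdem, ← Finset.add_sum_erase _ _ (a := R) (by simp), mul_add, Finset.mul_sum]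
    congr 1
    -- The order `R` itself is not among the `U ⊇ S`, so removing it from the larger index set loses
    -- nothing.
    refine (Finset.sum_subset_zero_on_sdiff (fun U hU => ?_) (fun U hU => ?_)
      fun U hU => ?_).symm
    · obtain ⟨hS, hR⟩ := (Finset.mem_filter.1 hU).2
      refine Finset.mem_erase.2 ⟨?_, by simpa using hR⟩
      rintro rfl
      exact h hS
    · obtain ⟨hU, hU'⟩ := Finset.mem_sdiff.1 hU
      obtain ⟨hne, hR⟩ := Finset.mem_erase.1 hU
      have hR' : R ≤ U := by simpa using hR
      exact ih U (lt_of_le_of_ne hR' hne.symm) fun hS => hU' (by simp [hS, hR'])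
    · exact (relClass_mul_orderIdem_of_subset k hrefl (Finset.mem_filter.1 hU).2.1).symm
  obtain ⟨V, hV, hprod⟩ | ⟨hU, hprod⟩ := relClass_mul_relClass_order k hrefl R
  · rw [hprod, ← sum_orderIdem] at hsum
    simp_rw [hV] at hsum
    exact left_eq_add.1 (by rwa [add_comm] at hsum)
  · simp_rw [hprod, hU] at hsum
    simpa using hsum.symm

/-- The relation `{(e, g e)}` attached to a permutation. -/
def permRel (g : Equiv.Perm E) : SetRel E E := {p | g p.1 = p.2}

/-- Every relation is the product of a permutation and a relation with permuted rows. -/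
theorem permRel_comp (g : Equiv.Perm E) (Q : SetRel E E) :
    SetRel.comp (permRel g) {p | (g.symm p.1, p.2) ∈ Q} = Q := by
  ext ⟨a, b⟩
  constructor
  · rintro ⟨c, hc, h⟩
    obtain rfl : g a = c := hc
    simpa using h
  · intro h
    exact ⟨g a, rfl, by simpa using h⟩

/-- After `g` is split off on the left, the remaining factor is reflexive by `hg` and contained in
`R` by `hQ`, hence fixes `f_R`. -/
theorem relClass_mul_orderIdem_of_perm (Q : SetRel E E) (R : OrderOn E) (g : Equiv.Perm E)
    (hg : ∀ e, (e, g e) ∈ Q) (hQ : ∀ e x, (e, x) ∈ Q → (g e, x) ∈ R.1) :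
    relClass k Q * orderIdem k E R = relClass k (permRel g) * orderIdem k E R := by
  rw [← permRel_comp g Q, relClass_comp, mul_assoc, relClass_mul_orderIdem_of_subset]
  · exact fun a => by simpa using hg (g.symm a)
  · rintro ⟨a, b⟩ hab
    simpa using hQ _ _ hab

/-- There are two ways to vanish: `Q` contains no permutation and is inessential, or the reflexive
factor left after splitting one off is not contained in `R`. -/
theorem relClass_mul_orderIdem_eq_zero (Q : SetRel E E) (R : OrderOn E)
    (h : ∀ g : Equiv.Perm E, (∀ e, (e, g e) ∈ Q) → ∃ e x, (e, x) ∈ Q ∧ (g e, x) ∉ R.1) :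
    relClass k Q * orderIdem k E R = 0 := by
  by_cases hQ : ∃ g : Equiv.Perm E, ∀ e, (e, g e) ∈ Q
  · obtain ⟨g, hg⟩ := hQ
    obtain ⟨e, x, hex, hR⟩ := h g hg
    rw [← permRel_comp g Q, relClass_comp, mul_assoc, relClass_mul_orderIdem_of_not_subset,
      mul_zero]
    · exact fun a => by simpa using hg (g.symm a)
    · exact fun hsub => hR (hsub (a := (g e, x)) (by simpa using hex))
  · push Not at hQ
    rw [relClass_eq_zero k (.of_forall_perm hQ), zero_mul]

end Idempotents

/-! ### Relations acting on the maps to a lattice -/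

section Lattice

variable {T : Type u} [Lattice T] [BoundedOrder T]

theorem le_corrAct {X Y : FinCorr.{u}} {S : SetRel Y X} (φ : X → T) {y : Y} {x : X}
    (h : (y, x) ∈ S) : φ x ≤ corrAct S φ y :=
  Finset.le_sup (f := φ) (by simpa using h)

theorem corrAct_le {X Y : FinCorr.{u}} {S : SetRel Y X} {φ : X → T} {y : Y} {t : T}
    (h : ∀ x, (y, x) ∈ S → φ x ≤ t) : corrAct S φ y ≤ t :=
  Finset.sup_le fun x hx => h x (by simpa using hx)

/-- An irreducible element is not the empty join, and a finite join equal to it must attain it. -/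
theorem exists_eq_of_corrAct_eq {X Y : FinCorr.{u}} {S : SetRel Y X} {φ : X → T} {y : Y} {t : T}
    (ht : SupIrred t) (h : corrAct S φ y = t) : ∃ x, (y, x) ∈ S ∧ φ x = t := by
  obtain ⟨x, hx, hxt⟩ := ht.finset_sup_eq h
  exact ⟨x, by simpa using hx, hxt⟩

variable [Finite T]

/-- The relation `{(x, e) | e ≤ φ x}` between a set and the irreducible elements. -/
def lowerRel {X : FinCorr.{u}} (φ : X → T) : SetRel X (irrSet T) := {p | p.2.1 ≤ φ p.1}

theorem corrAct_lowerRel {X : FinCorr.{u}} (φ : X → T) :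
    corrAct (lowerRel φ) (irrIncl T) = φ := by
  funext x
  refine le_antisymm (corrAct_le fun e he => he) ?_
  -- In a finite lattice every element is a join of irreducibles, all of which lie below it.
  obtain ⟨s, hs, hirr⟩ := exists_supIrred_decomposition (φ x)
  rw [← hs]
  refine Finset.sup_le fun t ht => ?_
  refine le_corrAct (irrIncl T) (x := (⟨t, hirr ht⟩ : irrSet T)) ?_
  exact (Finset.le_sup (f := id) ht).trans hs.le

/-- The permutation `g` is read off from `Q` by taking joins. -/
theorem corrAct_irrIncl_eq_iff (Q : SetRel (irrSet T) (irrSet T)) (g : Equiv.Perm (irrSet T)) :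
    corrAct Q (irrIncl T) = irrIncl T ∘ g ↔
      (∀ e, (e, g e) ∈ Q) ∧ ∀ e x, (e, x) ∈ Q → (g e, x) ∈ (irrOrder T).op.1 := by
  constructor
  · intro h
    refine ⟨fun e => ?_, fun e x hex => ?_⟩
    · obtain ⟨x, hx, hxe⟩ := exists_eq_of_corrAct_eq (g e).2 (congrFun h e)
      rwa [Subtype.ext hxe] at hx
    · exact (le_corrAct (irrIncl T) hex).trans (congrFun h e).le
  · rintro ⟨hg, hQ⟩
    funext e
    exact le_antisymm (corrAct_le fun x hx => hQ e x hx) (le_corrAct (irrIncl T) (hg e))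

variable (k : Type v) [CommRing k]

theorem relClass_mul_orderIdem_irrOrder_eq_zero (Q : SetRel (irrSet T) (irrSet T))
    (h : ∀ g : Equiv.Perm (irrSet T), corrAct Q (irrIncl T) ≠ irrIncl T ∘ g) :
    relClass k Q * orderIdem k (irrSet T) (irrOrder T).op = 0 := by
  refine relClass_mul_orderIdem_eq_zero k Q _ fun g hg => ?_
  by_contra! hQ
  exact h g ((corrAct_irrIncl_eq_iff Q g).2 ⟨hg, hQ⟩)

/-- In `𝒫_E`, the product `Q f_{Rᵒᵖ}` depends only on `Q ι`. -/
theorem relClass_mul_orderIdem_congr {Q Q' : SetRel (irrSet T) (irrSet T)}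
    (h : corrAct Q (irrIncl T) = corrAct Q' (irrIncl T)) :
    relClass k Q * orderIdem k (irrSet T) (irrOrder T).op =
      relClass k Q' * orderIdem k (irrSet T) (irrOrder T).op := by
  -- If `Q ι = ι ∘ g`, both products are `g f`; if there is no such `g`, both are zero.
  by_cases hg : ∃ g : Equiv.Perm (irrSet T), corrAct Q (irrIncl T) = irrIncl T ∘ g
  · obtain ⟨g, hg⟩ := hg
    obtain ⟨h₁, h₂⟩ := (corrAct_irrIncl_eq_iff Q g).1 hg
    obtain ⟨h₁', h₂'⟩ := (corrAct_irrIncl_eq_iff Q' g).1 (h ▸ hg)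
    rw [relClass_mul_orderIdem_of_perm k Q _ g h₁ h₂,
      relClass_mul_orderIdem_of_perm k Q' _ g h₁' h₂']
  · push Not at hg
    rw [relClass_mul_orderIdem_irrOrder_eq_zero k Q hg,
      relClass_mul_orderIdem_irrOrder_eq_zero k Q' (h ▸ hg)]

end Lattice

/-! ### The fundamental functors -/

section FundamentalFunctor

variable {k : Type v} [CommRing k] {E : FinCorr.{u}} {R : OrderOn E}

/-- The projection `k𝒞(X, E) ⊗ 𝒫_E f_R → 𝕊_{E,R}(X)`. -/
noncomputable def fundamentalProj (R : OrderOn E) (X : LinCorr.{u} k) :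
    ((Free.of k E ⟶ X) ⊗[k] FundamentalModule k E R) →ₗ[k] (fundamentalFunctor k E R).obj X :=
  ((JSubfunctor k E (FundamentalModule k E R)).obj X).mkQ ∘ₗ
    (balancedRel k E (FundamentalModule k E R) X).mkQ

theorem fundamentalProj_surjective (X : LinCorr.{u} k) :
    Function.Surjective (fundamentalProj R X) :=
  (Submodule.mkQ_surjective _).comp (Submodule.mkQ_surjective _)

theorem fundamentalProj_comp_tmul {X : LinCorr.{u} k} (φ : Free.of k E ⟶ X) (a : RelAlg k E)
    (x : FundamentalModule k E R) :
    fundamentalProj R X ((a.asHom ≫ φ) ⊗ₜ x) = fundamentalProj R X (φ ⊗ₜ (a • x)) :=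
  congrArg ((JSubfunctor k E (FundamentalModule k E R)).obj X).mkQ (ltmul_comp E _ φ a x)

/-- The linear map `k𝒞(X, E) → 𝕊_{E,R}(X)` sending `φ` to the class of `φ ⊗ f_R`. -/
noncomputable def fundamentalClass (R : OrderOn E) (X : LinCorr.{u} k) :
    (Free.of k E ⟶ X) →ₗ[k] (fundamentalFunctor k E R).obj X :=
  fundamentalProj R X ∘ₗ (TensorProduct.mk k _ _).flip (fundamentalGen k E R)

theorem fundamentalFunctor_map_class {X Y : LinCorr.{u} k} (g : X ⟶ Y) (φ : Free.of k E ⟶ X) :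
    ((fundamentalFunctor k E R).map g).hom (fundamentalClass R X φ) =
      fundamentalClass R Y (φ ≫ g) :=
  rfl

theorem fundamentalEval_gen :
    fundamentalEval k E R (fundamentalGen k E R) =
      fundamentalClass R (Free.of k E) (𝟙 (Free.of k E)) := rfl

/-- The functor `𝕊_{E,R}` is generated by `f_R`. -/
theorem fundamentalClass_surjective (X : LinCorr.{u} k) :
    Function.Surjective (fundamentalClass R X) := by
  intro s
  obtain ⟨t, rfl⟩ := fundamentalProj_surjective X s
  induction t with
  | zero => exact ⟨0, by rw [map_zero, map_zero]⟩
  | add t t' h h' =>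
    obtain ⟨φ, h⟩ := h
    obtain ⟨φ', h'⟩ := h'
    exact ⟨φ + φ', by rw [map_add, map_add, h, h']⟩
  | tmul φ x =>
    obtain ⟨x, hx⟩ := x
    obtain ⟨p, rfl⟩ := Ideal.mem_span_singleton'.1 hx
    obtain ⟨a, rfl⟩ := RingQuot.mkAlgHom_surjective k (PermutedOrderRel k E) p
    -- A lift `a` of `p` to `k𝒞(E, E)` turns `p f_R` into `a • f_R`, and `a` then moves across the
    -- tensor sign.
    exact ⟨a.asHom ≫ φ, fundamentalProj_comp_tmul φ a _⟩

/-- Elements of `𝕊_{E,R}(X)` are detected by the relations between `E` and `X`. -/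
theorem fundamentalClass_eq_zero {X : FinCorr.{u}} {φ : Free.of k E ⟶ Free.of k X}
    (h : ∀ S : SetRel E X,
      PermutedOrderAlg.mk k E (End.of (φ ≫ relHom k S)) * orderIdem k E R = 0) :
    fundamentalClass R (Free.of k X) φ = 0 := by
  refine (Submodule.Quotient.mk_eq_zero _).2 ((Submodule.mem_iInf _).2 fun ψ => Subtype.ext ?_)
  change PermutedOrderAlg.mk k E (End.of (φ ≫ ψ)) * orderIdem k E R = 0
  refine LinCorr.hom_induction k (P := fun ψ =>
    PermutedOrderAlg.mk k E (End.of (φ ≫ ψ)) * orderIdem k E R = 0) ψ ?_ ?_ ?_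
  · rw [Limits.comp_zero]
    exact (congrArg (· * _) (map_zero (PermutedOrderAlg.mk k E))).trans (zero_mul _)
  · intro ψ ψ' h h'
    rw [Preadditive.comp_add]
    refine (congrArg (· * _) (map_add (PermutedOrderAlg.mk k E) (End.of (φ ≫ ψ))
      (End.of (φ ≫ ψ')))).trans ?_
    rw [add_mul, h, h', add_zero]
  · intro c S
    rw [Linear.comp_smul]
    refine (congrArg (· * _) (map_smul (PermutedOrderAlg.mk k E) c
      (End.of (φ ≫ relHom k S)))).trans ?_
    rw [smul_mul_assoc, h, smul_zero]

theorem fundamentalClass_relHom_eq_zero {X : FinCorr.{u}} {A : SetRel X E}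
    (h : ∀ S : SetRel E X, relClass k (SetRel.comp S A) * orderIdem k E R = 0) :
    fundamentalClass R (Free.of k X) (relHom k A) = 0 := by
  refine fundamentalClass_eq_zero fun S => ?_
  rw [relHom_comp]
  exact h S

theorem fundamentalClass_relHom_congr {X : FinCorr.{u}} {A B : SetRel X E}
    (h : ∀ S : SetRel E X, relClass k (SetRel.comp S A) * orderIdem k E R =
      relClass k (SetRel.comp S B) * orderIdem k E R) :
    fundamentalClass R (Free.of k X) (relHom k A) =
      fundamentalClass R (Free.of k X) (relHom k B) := by
  rw [← sub_eq_zero, ← map_sub]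
  refine fundamentalClass_eq_zero fun S => ?_
  rw [Preadditive.sub_comp, relHom_comp, relHom_comp]
  refine (congrArg (· * _) (map_sub (PermutedOrderAlg.mk k E) (End.of (relHom k _))
    (End.of (relHom k _)))).trans ?_
  rw [sub_mul, sub_eq_zero]
  exact h S

end FundamentalFunctor

/-! ### The morphism from the functor of a lattice to a fundamental functor -/

section Theta

variable (k : Type v) [CommRing k] (T : Type u) [Lattice T]

/-- The linear map sending `φ : X → T` to the class of `{(x, e) | e ≤ φ x} ⊗ f_{Rᵒᵖ}`. -/
noncomputable def thetaApp [Finite T] (X : FinCorr.{u}) :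
    ((X → T) →₀ k) →ₗ[k] (fundamentalFunctor k (irrSet T) (irrOrder T).op).obj (Free.of k X) :=
  Finsupp.linearCombination k fun φ =>
    fundamentalClass (irrOrder T).op (Free.of k X) (relHom k (lowerRel φ))

variable {T} in
theorem thetaApp_single [Finite T] {X : FinCorr.{u}} (φ : X → T) :
    thetaApp k T X (Finsupp.single φ 1) =
      fundamentalClass (irrOrder T).op (Free.of k X) (relHom k (lowerRel φ)) :=
  (Finsupp.linearCombination_single k (1 : k) φ).trans (one_smul k _)

variable [BoundedOrder T]

variable {T} in
theorem latticeFunctor_map_relHom {X Y : FinCorr.{u}} (S : SetRel Y X) (φ : X → T) :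
    ((latticeFunctor T k).map (relHom k S)).hom (latticeBasis k φ) =
      latticeBasis k (corrAct S φ) :=
  (congrArg (fun f => f (Finsupp.single φ 1)) (latticeMap_relHom T k S)).trans
    Finsupp.mapDomain_single

variable [Finite T]

-- This exhibits `ι` as a generator of `F_T`.
variable {T} in
theorem latticeBasis_eq_map {X : FinCorr.{u}} (φ : X → T) :
    latticeBasis k φ =
      ((latticeFunctor T k).map (relHom k (lowerRel φ))).hom (latticeBasis k (irrIncl T)) := by
  rw [latticeFunctor_map_relHom, corrAct_lowerRel]

variable {T} in
/-- The class of `A ⊗ f_{Rᵒᵖ}` depends only on `A ι`. -/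
theorem fundamentalClass_lowerRel_corrAct {X : FinCorr.{u}} (A : SetRel X (irrSet T)) :
    fundamentalClass (k := k) (irrOrder T).op (Free.of k X)
        (relHom k (lowerRel (corrAct A (irrIncl T)))) =
      fundamentalClass (irrOrder T).op (Free.of k X) (relHom k A) := by
  -- Both relations send `ι` to the same map, and still do so after composition with any `S`.
  refine fundamentalClass_relHom_congr fun S => relClass_mul_orderIdem_congr k ?_
  rw [corrAct_comp, corrAct_comp, corrAct_lowerRel]

/-- For a correspondence `S`, the relations `lowerRel (S φ)` and `S ∘ lowerRel φ` may differ, but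
both send `ι` to `S φ`, so their classes agree. -/
theorem thetaApp_naturality {X Y : FinCorr.{u}}
    (f : (Free.of k X : LinCorr.{u} k) ⟶ Free.of k Y) :
    thetaApp k T Y ∘ₗ latticeMap T k X Y f =
      ((fundamentalFunctor k (irrSet T) (irrOrder T).op).map f).hom ∘ₗ thetaApp k T X := by
  refine Finsupp.lhom_ext' fun φ => LinearMap.ext_ring ?_
  change thetaApp k T Y (latticeMap T k X Y f (Finsupp.single φ 1)) =
    ((fundamentalFunctor k (irrSet T) (irrOrder T).op).map f).hom
      (thetaApp k T X (Finsupp.single φ 1))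
  rw [thetaApp_single, fundamentalFunctor_map_class]
  refine LinCorr.hom_induction k (P := fun f =>
    thetaApp k T Y (latticeMap T k X Y f (Finsupp.single φ 1)) =
      fundamentalClass (irrOrder T).op (Free.of k Y) (relHom k (lowerRel φ) ≫ f)) f ?_ ?_ ?_
  · rw [map_zero, LinearMap.zero_apply, map_zero, Limits.comp_zero, map_zero]
  · intro f g hf hg
    rw [map_add, LinearMap.add_apply, map_add, hf, hg, Preadditive.comp_add, map_add]
  · intro c S
    rw [map_smul, LinearMap.smul_apply, map_smul, Linear.comp_smul, map_smul, latticeMap_relHom,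
      Finsupp.lmapDomain_apply, Finsupp.mapDomain_single, thetaApp_single, relHom_comp,
      ← fundamentalClass_lowerRel_corrAct k (SetRel.comp S (lowerRel φ)), corrAct_comp,
      corrAct_lowerRel]

/-- The morphism `Θ_T : F_T ⟶ 𝕊_{E,Rᵒᵖ}`. -/
noncomputable def theta :
    latticeFunctor T k ⟶ fundamentalFunctor k (irrSet T) (irrOrder T).op where
  app X := ModuleCat.ofHom (thetaApp k T X.toFin)
  naturality X Y f := ModuleCat.hom_ext (thetaApp_naturality k T (X := X.toFin) (Y := Y.toFin) f)

variable {T} in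
theorem theta_app_basis {X : FinCorr.{u}} (φ : X → T) :
    ((theta k T).app (Free.of k X)).hom (latticeBasis k φ) =
      fundamentalClass (irrOrder T).op (Free.of k X) (relHom k (lowerRel φ)) :=
  thetaApp_single k φ

theorem theta_app_irrIncl :
    ((theta k T).app (Free.of k (irrSet T))).hom (latticeBasis k (irrIncl T)) =
      fundamentalEval k (irrSet T) (irrOrder T).op
        (fundamentalGen k (irrSet T) (irrOrder T).op) := by
  -- The relation `lowerRel ι` is `Rᵒᵖ`, not the identity, but both send `ι` to `ι`.
  have h := fundamentalClass_lowerRel_corrAct (T := T) k (SetRel.id : SetRel (irrSet T) (irrSet T))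
  rw [corrAct_id, relHom_id] at h
  rw [theta_app_basis, fundamentalEval_gen, h]

/-- Morphisms from `F_T` are determined by their value at `ι`. -/
theorem latticeFunctor_hom_ext {M : LinCorr.{u} k ⥤ ModuleCat.{max u v} k}
    {θ θ' : latticeFunctor T k ⟶ M}
    (h : (θ.app (Free.of k (irrSet T))).hom (latticeBasis k (irrIncl T)) =
      (θ'.app (Free.of k (irrSet T))).hom (latticeBasis k (irrIncl T))) : θ = θ' := by
  refine NatTrans.ext (funext fun X => ModuleCat.hom_ext
    (Finsupp.lhom_ext' fun φ => LinearMap.ext_ring ?_))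
  change (θ.app (Free.of k X.toFin)).hom (latticeBasis k φ) =
    (θ'.app (Free.of k X.toFin)).hom (latticeBasis k φ)
  rw [latticeBasis_eq_map]
  exact (ConcreteCategory.congr_hom (θ.naturality _) _).trans
    ((congrArg (M.map _).hom h).trans (ConcreteCategory.congr_hom (θ'.naturality _) _).symm)

theorem theta_app_surjective (X : LinCorr.{u} k) :
    Function.Surjective ((theta k T).app X).hom := by
  intro s
  obtain ⟨φ, rfl⟩ := fundamentalClass_surjective X s
  refine ⟨((latticeFunctor T k).map φ).hom (latticeBasis k (irrIncl T)), ?_⟩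
  refine (ConcreteCategory.congr_hom ((theta k T).naturality φ) _).trans
    ((congrArg (((fundamentalFunctor k (irrSet T) (irrOrder T).op).map φ).hom)
      (theta_app_irrIncl k T)).trans ?_)
  rw [fundamentalEval_gen, fundamentalFunctor_map_class, Category.id_comp]

theorem latticeH_le_ker_theta : latticeH T k ≤ CorrSubfunctor.ker (theta k T) := by
  intro X
  refine Submodule.span_le.2 ?_
  rintro _ ⟨φ, hφ, rfl⟩
  refine (theta_app_basis (X := X.toFin) k φ).trans (fundamentalClass_relHom_eq_zero fun S =>
    relClass_mul_orderIdem_irrOrder_eq_zero k _ fun g hg => hφ fun t ht => ?_)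
  rw [corrAct_comp, corrAct_lowerRel] at hg
  -- If some `S φ` were `ι ∘ g`, it would take the value `t`. As `t` is irreducible, `φ` would take
  -- it too.
  obtain ⟨e, he⟩ : ∃ e, g e = (⟨t, ht⟩ : {e : T // SupIrred e}) := g.surjective _
  have h : corrAct S φ e = t := (congrFun hg e).trans (congrArg Subtype.val he)
  obtain ⟨x, -, hx⟩ := exists_eq_of_corrAct_eq ht h
  exact ⟨x, hx⟩

end Theta

section Quotient

variable {k : Type v} [CommRing k] {M M' : LinCorr.{u} k ⥤ ModuleCat.{w} k}

/-- A morphism of functors that vanishes on a subfunctor factors through the quotient. -/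
noncomputable def CorrSubfunctor.desc (N : CorrSubfunctor M) (θ : M ⟶ M')
    (h : N ≤ CorrSubfunctor.ker θ) : N.quotient ⟶ M' where
  app X := ModuleCat.ofHom ((N.obj X).liftQ (θ.app X).hom (h X))
  naturality _ _ f := ModuleCat.hom_ext (Submodule.linearMap_qext _
    (LinearMap.ext fun m => ConcreteCategory.congr_hom (θ.naturality f) m))

theorem CorrSubfunctor.proj_desc (N : CorrSubfunctor M) (θ : M ⟶ M')
    (h : N ≤ CorrSubfunctor.ker θ) : N.proj ≫ N.desc θ h = θ := rfl

theorem CorrSubfunctor.quotient_hom_ext {N : CorrSubfunctor M} {θ θ' : N.quotient ⟶ M'}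
    (h : N.proj ≫ θ = N.proj ≫ θ') : θ = θ' :=
  NatTrans.ext (funext fun X => ModuleCat.hom_ext (Submodule.linearMap_qext _
    (LinearMap.ext fun m => ConcreteCategory.congr_hom (NatTrans.congr_app h X) m)))

end Quotient

theorem mainTheorem3 (k : Type v) [CommRing k] (T : Type u) [Lattice T] [BoundedOrder T]
    [Finite T] :
    ∃ Θ : latticeFunctor T k ⟶ fundamentalFunctor k (irrSet T) (irrOrder T).op,
      ((Θ.app (Free.of k (irrSet T))).hom (latticeBasis k (irrIncl T)) =
          fundamentalEval k (irrSet T) (irrOrder T).op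
            (fundamentalGen k (irrSet T) (irrOrder T).op) ∧
        ∀ Θ' : latticeFunctor T k ⟶ fundamentalFunctor k (irrSet T) (irrOrder T).op,
          (Θ'.app (Free.of k (irrSet T))).hom (latticeBasis k (irrIncl T)) =
            fundamentalEval k (irrSet T) (irrOrder T).op
              (fundamentalGen k (irrSet T) (irrOrder T).op) → Θ' = Θ) ∧
      (∀ X : LinCorr.{u} k, Function.Surjective (Θ.app X).hom) ∧
      latticeH T k ≤ CorrSubfunctor.ker Θ ∧
      ∃ Θbar : (latticeH T k).quotient ⟶ fundamentalFunctor k (irrSet T) (irrOrder T).op,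
        ((latticeH T k).proj ≫ Θbar = Θ ∧
          ∀ Θbar' : (latticeH T k).quotient ⟶ fundamentalFunctor k (irrSet T) (irrOrder T).op,
            (latticeH T k).proj ≫ Θbar' = Θ → Θbar' = Θbar) ∧
        ∀ X : LinCorr.{u} k, Function.Surjective (Θbar.app X).hom := by
  refine ⟨theta k T, ⟨theta_app_irrIncl k T, fun Θ' h =>
      latticeFunctor_hom_ext k T (h.trans (theta_app_irrIncl k T).symm)⟩,
    theta_app_surjective k T, latticeH_le_ker_theta k T,
    (latticeH T k).desc (theta k T) (latticeH_le_ker_theta k T),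
    ⟨CorrSubfunctor.proj_desc _ _ _, fun Θbar' h => CorrSubfunctor.quotient_hom_ext h⟩,
    fun X s => ?_⟩
  obtain ⟨m, rfl⟩ := theta_app_surjective k T X s
  exact ⟨((latticeH T k).proj.app X).hom m, rfl⟩
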